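/- All graphs are finite and simple. A set $S$ of vertices of a graph $G$ is $t$-equidistant if $d(u,v)=t$ for all distinct $u,v\in S$, and $\mathrm{eq}_t(G)$ is the number of vertices in a largest $t$-equidistant set. The Johnson graph $J(n,k)$ has as vertices the $k$-element subsets of an $n$-element set, two of them being adjacent iff they differ by exactly one element. For an $r$-regular graph $G$ on $N$ vertices with distinct adjacency eigenvalues $r=\theta_0>\theta_1>\dots>\theta_d$ consider the following two upper bounds. (B3) If $d\ge 2$ and $\theta_i$ is the largest eigenvalue with $\theta_i\le -1$, the ratio-type bound on $\mathrm{eq}_3(G)$ is $$B_3(G)=N\,\frac{\theta_0+\theta_i\theta_{i-1}}{(\theta_0-\theta_i)(\theta_0-\theta_{i-1})}.$$ (B4) If $d\ge 3$, $\Delta_3=\max_{u}(A^3)_{uu}$ where $A$ is the adjacency matrix, and $\theta_s$ ($s\ge 1$) is the largest eigenvalue with $\theta_s\le -\frac{\theta_0^2+\theta_0\theta_d-\Delta_3}{\theta_0(\theta_d+1)}$, the ratio-type bound on $\mathrm{eq}_4(G)$ is $$B_4(G)=N\,\frac{\Delta_3-\theta_0(\theta_s+\theta_{s-1}+\theta_d)-\theta_s\theta_{s-1}\theta_d}{(\theta_0-\theta_s)(\theta_0-\theta_{s-1})(\theta_0-\theta_d)}.$$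 Proposition. (1) For all integers $n\ge 0$ and $k\ge 1$, a set of vertices of $J(n,k)$ is $k$-equidistant if and only if its members are pairwise disjoint $k$-subsets, and $\mathrm{eq}_k(J(n,k))=\lfloor n/k\rfloor$. (2) For every $n>6$ the assumptions of (B3) hold for $G=J(n,3)$, and the bound is tight: $B_3(J(n,3))=n/3$ and $\mathrm{eq}_3(J(n,3))=\lfloor B_3(J(n,3))\rfloor=\lfloor n/3\rfloor$. (3) For every $n>8$ the assumptions of (B4) hold for $G=J(n,4)$, and the bound is tight: $B_4(J(n,4))=n/4$ and $\mathrm{eq}_4(J(n,4))=\lfloor B_4(J(n,4))\rfloor=\lfloor n/4\rfloor$. -/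

import Mathlib

/-- A set `S` of vertices is `t`-equidistant if any two distinct vertices of `S` are at distance
exactly `t` (distances are taken in `ℕ∞`, so vertices in different components are at distance
`⊤`). -/
def IsEquidistantSet {V : Type*} (G : SimpleGraph V) (t : ℕ) (S : Set V) : Prop :=
  ∀ u ∈ S, ∀ v ∈ S, u ≠ v → G.edist u v = (t : ℕ∞)

/-- The `t`-equidistant number of a finite graph: the number of vertices in a largest
`t`-equidistant set. -/
noncomputable def equidistantNumber {V : Type*} [Fintype V] (G : SimpleGraph V) (t : ℕ) : ℕ :=
  sSup {m : ℕ | ∃ S : Finset V, IsEquidistantSet G t (S : Set V) ∧ S.card = m}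

/-- On a finite graph the supremum defining the `t`-equidistant number is a maximum. -/
theorem equidistantNumber_isGreatest {V : Type*} [Fintype V] (G : SimpleGraph V) (t : ℕ) :
    IsGreatest {m : ℕ | ∃ S : Finset V, IsEquidistantSet G t (S : Set V) ∧ S.card = m}
      (equidistantNumber G t) := by
  have hb : BddAbove {m : ℕ | ∃ S : Finset V, IsEquidistantSet G t (S : Set V) ∧ S.card = m} :=
    ⟨Fintype.card V, by rintro m ⟨S, -, rfl⟩; exact S.card_le_univ⟩
  exact ⟨Nat.sSup_mem ⟨0, ∅, by simp [IsEquidistantSet], rfl⟩ hb, fun m hm => le_csSup hb hm⟩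

/-- The Johnson graph `J(n,k)`: the vertices are the `k`-element subsets of an `n`-element set, and
two of them are adjacent iff they differ by exactly one element. -/
def johnsonGraph (n k : ℕ) : SimpleGraph {s : Finset (Fin n) // s.card = k} where
  Adj s t := (s.1 \ t.1).card = 1 ∧ (t.1 \ s.1).card = 1
  symm := ⟨fun _ _ h => ⟨h.2, h.1⟩⟩
  loopless := ⟨fun s h => by simp at h⟩

instance (n k : ℕ) : DecidableRel (johnsonGraph n k).Adj := fun s t =>
  inferInstanceAs (Decidable ((s.1 \ t.1).card = 1 ∧ (t.1 \ s.1).card = 1))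

/-- `G` is `r`-regular and `r = θ 0 > θ 1 > ⋯ > θ d` are all its distinct adjacency
eigenvalues. -/
structure IsRegularWithEigenvalues {V : Type*} [Fintype V] [DecidableEq V] (G : SimpleGraph V)
    [DecidableRel G.Adj] (r d : ℕ) (θ : Fin (d + 1) → ℝ) : Prop where
  regular : G.IsRegularOfDegree r
  strictAnti : StrictAnti θ
  range_eq : Set.range θ = spectrum ℝ (G.adjMatrix ℝ)
  zero_eq : θ 0 = (r : ℝ)

/-- The assumptions of the ratio-type bound for `t = 3`. The index `i : Fin d` is shifted by one:
`θ i.succ` is the largest eigenvalue that is at most `-1`, and `θ i.castSucc` is the distinct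
eigenvalue just above it. -/
structure RatioThreeSetting {V : Type*} [Fintype V] [DecidableEq V] (G : SimpleGraph V)
    [DecidableRel G.Adj] (r d : ℕ) (θ : Fin (d + 1) → ℝ) (i : Fin d) : Prop where
  eigenvalues : IsRegularWithEigenvalues G r d θ
  two_le : 2 ≤ d
  isGreatest : IsGreatest {x : ℝ | x ∈ Set.range θ ∧ x ≤ -1} (θ i.succ)

/-- The value of the ratio-type bound for `t = 3`, for a graph with `N` vertices. -/
noncomputable def ratioBoundThree (N : ℕ) {d : ℕ} (θ : Fin (d + 1) → ℝ) (i : Fin d) : ℝ :=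
  N * ((θ 0 + θ i.succ * θ i.castSucc) / ((θ 0 - θ i.succ) * (θ 0 - θ i.castSucc)))

/-- The assumptions of the ratio-type bound for `t = 4`. Here `Δ` is the largest diagonal entry of
the cube of the adjacency matrix, `θ s.succ` is the largest eigenvalue below the given threshold,
and `θ s.castSucc` is the distinct eigenvalue just above it. -/
structure RatioFourSetting {V : Type*} [Fintype V] [DecidableEq V] (G : SimpleGraph V)
    [DecidableRel G.Adj] (r d : ℕ) (θ : Fin (d + 1) → ℝ) (Δ : ℝ) (s : Fin d) : Prop where
  eigenvalues : IsRegularWithEigenvalues G r d θ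
  three_le : 3 ≤ d
  isGreatest_diag : IsGreatest (Set.range fun u : V => (G.adjMatrix ℝ ^ 3) u u) Δ
  isGreatest : IsGreatest {x : ℝ | x ∈ Set.range θ ∧
    x ≤ -((θ 0 ^ 2 + θ 0 * θ (Fin.last d) - Δ) / (θ 0 * (θ (Fin.last d) + 1)))} (θ s.succ)

/-- The value of the ratio-type bound for `t = 4`, for a graph with `N` vertices. -/
noncomputable def ratioBoundFour (N : ℕ) {d : ℕ} (θ : Fin (d + 1) → ℝ) (Δ : ℝ) (s : Fin d) : ℝ :=
  N * ((Δ - θ 0 * (θ s.succ + θ s.castSucc + θ (Fin.last d))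
      - θ s.succ * θ s.castSucc * θ (Fin.last d)) /
    ((θ 0 - θ s.succ) * (θ 0 - θ s.castSucc) * (θ 0 - θ (Fin.last d))))

open Finset

/-! ### Distances in the Johnson graph -/

/-! Distance in `J(n,k)` is `|u \ v|`, so distance `k` means disjointness, and a largest family of
disjoint `k`-sets has `⌊n/k⌋` members. The bounds need the spectrum. On functions supported on level
`k`, `upOp ∘ downOp` acts as `A + k`, and the commutator of the two operators is the scalar `n - 2k`
(`IsSupportedOnLevel.downOp_upOp`). Since `UD` and `DU` share nonzero eigenvalues,
`hasLevelEigenvalue_succ_iff` gets the eigenvalues of level `k + 1` from those of level `k`, plus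
`0`. For (B4), every edge lies in `n - 2` triangles, so `A ^ 3` has constant diagonal. The order of
the eigenvalues then fixes every quantity in the bounds, and both numerators are constants (`12` and
`144`), so the denominators cancel against the binomial coefficients. -/

theorem Finset.card_sdiff_comm_of_card_eq {α : Type*} [DecidableEq α] {s t : Finset α}
    (h : s.card = t.card) : (s \ t).card = (t \ s).card := by
  have h1 := Finset.card_sdiff_add_card_inter s t
  have h2 := Finset.card_sdiff_add_card_inter t s
  rw [Finset.inter_comm] at h2
  omega

/-- The vertex of the Johnson graph obtained by exchanging an element of `s` for a new one. -/
def johnsonSwap {n k : ℕ} (s : {s : Finset (Fin n) // s.card = k}) (x y : Fin n)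
    (hx : x ∈ s.1) (hy : y ∉ s.1) : {s : Finset (Fin n) // s.card = k} :=
  ⟨insert y (s.1.erase x), by
    have := card_pos.2 ⟨x, hx⟩
    rw [card_insert_of_notMem (fun h => hy (mem_of_mem_erase h)), card_erase_of_mem hx]
    have := s.2
    omega⟩

theorem sdiff_insert_erase {α : Type*} [DecidableEq α] {s : Finset α} {x y : α}
    (hx : x ∈ s) (hy : y ∉ s) : s \ insert y (s.erase x) = {x} := by
  ext z; simp only [mem_sdiff, mem_insert, mem_erase, mem_singleton]; grind

theorem insert_erase_sdiff {α : Type*} [DecidableEq α] {s : Finset α} {x y : α}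
    (hy : y ∉ s) : insert y (s.erase x) \ s = {y} := by
  ext z; simp only [mem_sdiff, mem_insert, mem_erase, mem_singleton]; grind

theorem johnsonGraph_adj_swap {n k : ℕ} (s : {s : Finset (Fin n) // s.card = k}) (x y : Fin n)
    (hx : x ∈ s.1) (hy : y ∉ s.1) : (johnsonGraph n k).Adj s (johnsonSwap s x y hx hy) := by
  refine ⟨?_, ?_⟩
  · simp [johnsonSwap, sdiff_insert_erase hx hy]
  · simp [johnsonSwap, insert_erase_sdiff hy]

theorem johnsonGraph_card_sdiff_le_length {n k : ℕ} {u v : {s : Finset (Fin n) // s.card = k}}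
    (p : (johnsonGraph n k).Walk u v) : (u.1 \ v.1).card ≤ p.length := by
  induction p with
  | nil => simp
  | @cons u v w h p ih =>
    have h1 : u.1 \ w.1 ⊆ (u.1 \ v.1) ∪ (v.1 \ w.1) := by
      intro z; simp only [mem_sdiff, mem_union]; tauto
    have h2 := (card_le_card h1).trans (card_union_le _ _)
    have h3 := h.1
    rw [SimpleGraph.Walk.length_cons]
    omega

/-- Exchanging an element of `u \ v` for one of `v \ u` shrinks the difference by exactly one. -/
theorem johnsonGraph_exists_walk {n k : ℕ} (m : ℕ) (u v : {s : Finset (Fin n) // s.card = k})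
    (h : (u.1 \ v.1).card = m) : ∃ p : (johnsonGraph n k).Walk u v, p.length = m := by
  induction m generalizing u with
  | zero =>
    have huv : u = v := Subtype.ext <| eq_of_subset_of_card_le
      (sdiff_eq_empty_iff_subset.1 (card_eq_zero.1 h)) (by rw [u.2, v.2])
    subst huv
    exact ⟨.nil, rfl⟩
  | succ m ih =>
    obtain ⟨x, hx⟩ := card_pos.1 (show 0 < (u.1 \ v.1).card by omega)
    have h' := card_sdiff_comm_of_card_eq (u.2.trans v.2.symm)
    obtain ⟨y, hy⟩ := card_pos.1 (show 0 < (v.1 \ u.1).card by omega)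
    have hx' := mem_sdiff.1 hx
    have hy' := mem_sdiff.1 hy
    have he : (johnsonSwap u x y hx'.1 hy'.2).1 \ v.1 = (u.1 \ v.1).erase x := by
      ext z; simp only [johnsonSwap, mem_sdiff, mem_insert, mem_erase]; grind
    obtain ⟨p, hp⟩ := ih (johnsonSwap u x y hx'.1 hy'.2) (by
      rw [he, card_erase_of_mem hx]; omega)
    exact ⟨.cons (johnsonGraph_adj_swap u x y hx'.1 hy'.2) p, by simp [hp]⟩

theorem johnsonGraph_edist {n k : ℕ} (u v : {s : Finset (Fin n) // s.card = k}) :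
    (johnsonGraph n k).edist u v = ((u.1 \ v.1).card : ℕ∞) := by
  obtain ⟨p, hp⟩ := johnsonGraph_exists_walk _ u v rfl
  refine le_antisymm (hp ▸ p.edist_le) ?_
  obtain ⟨q, hq⟩ := p.reachable.exists_walk_length_eq_edist
  rw [← hq]
  exact_mod_cast johnsonGraph_card_sdiff_le_length q

theorem johnsonGraph_isEquidistantSet_iff {n k : ℕ} (U : Set {s : Finset (Fin n) // s.card = k}) :
    IsEquidistantSet (johnsonGraph n k) k U ↔
      ∀ u ∈ U, ∀ v ∈ U, u ≠ v → Disjoint u.1 v.1 := by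
  refine forall₅_congr fun u _ v _ _ => ?_
  rw [johnsonGraph_edist, Nat.cast_inj, ← sdiff_eq_left]
  refine ⟨fun h => eq_of_subset_of_card_le sdiff_subset (by rw [h, u.2]), fun h => by rw [h, u.2]⟩

theorem exists_disjoint_blocks (n k : ℕ) (hk : 1 ≤ k) :
    ∃ S : Finset {s : Finset (Fin n) // s.card = k},
      (∀ u ∈ S, ∀ v ∈ S, u ≠ v → Disjoint u.1 v.1) ∧ S.card = n / k := by
  classical
  -- Pairs (block, position) embed in `Fin n` because `n / k * k ≤ n`; block `j` is the image of
  -- `{j} × Fin k`.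
  let e : Fin (n / k) × Fin k ↪ Fin n :=
    finProdFinEquiv.toEmbedding.trans (Fin.castLEEmb (Nat.div_mul_le_self n k))
  let b : Fin (n / k) → {s : Finset (Fin n) // s.card = k} := fun j =>
    ⟨univ.map ((Function.Embedding.sectR j (Fin k)).trans e), by simp⟩
  have hb : ∀ i j, i ≠ j → Disjoint (b i).1 (b j).1 := by
    intro i j hij
    rw [Finset.disjoint_left]
    intro z hz hz'
    simp only [b, mem_map, mem_univ, true_and, Function.Embedding.trans_apply] at hz hz'
    obtain ⟨a, rfl⟩ := hz
    obtain ⟨c, hc⟩ := hz'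
    exact hij (congrArg Prod.fst (e.injective hc)).symm
  have hinj : Function.Injective b := by
    intro i j hij
    by_contra hne
    have h := hb i j hne
    rw [hij, disjoint_self, bot_eq_empty, ← card_eq_zero, (b j).2] at h
    omega
  refine ⟨univ.map ⟨b, hinj⟩, ?_, by simp⟩
  simp only [mem_map, mem_univ, true_and, Function.Embedding.coeFn_mk]
  rintro _ ⟨i, rfl⟩ _ ⟨j, rfl⟩ hij
  exact hb i j fun h => hij (h ▸ rfl)

theorem equidistantNumber_johnsonGraph (n k : ℕ) (hk : 1 ≤ k) :
    equidistantNumber (johnsonGraph n k) k = n / k := by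
  refine (equidistantNumber_isGreatest (johnsonGraph n k) k).unique ⟨?_, ?_⟩
  · obtain ⟨S, hS, hc⟩ := exists_disjoint_blocks n k hk
    exact ⟨S, (johnsonGraph_isEquidistantSet_iff _).2 (by simpa using hS), hc⟩
  · rintro m ⟨S, hS, rfl⟩
    rw [johnsonGraph_isEquidistantSet_iff] at hS
    rw [Nat.le_div_iff_mul_le hk]
    have h := card_biUnion (s := S) (t := fun u => u.1) hS
    rw [sum_congr rfl fun u _ => u.2, sum_const, smul_eq_mul] at h
    rw [← h]
    simpa using card_le_univ (S.biUnion fun u => u.1)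

/-! ### Counting neighbours in the Johnson graph -/

/-- A neighbour `t` determines its exchange `(x, y)`, since `s \ t = {x}` and `t \ s = {y}`. -/
theorem johnsonGraph_sum_neighborFinset {M : Type*} [AddCommMonoid M] {n k : ℕ}
    (s : {s : Finset (Fin n) // s.card = k}) (g : Finset (Fin n) → M) :
    ∑ t ∈ (johnsonGraph n k).neighborFinset s, g t.1 =
      ∑ x ∈ s.1, ∑ y ∈ s.1ᶜ, g (insert y (s.1.erase x)) := by
  rw [← sum_product']
  symm
  refine sum_bij (fun p hp => johnsonSwap s p.1 p.2 (mem_product.1 hp).1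
    (mem_compl.1 (mem_product.1 hp).2)) ?_ ?_ ?_ ?_
  · intro p hp
    rw [SimpleGraph.mem_neighborFinset]
    exact johnsonGraph_adj_swap _ _ _ _ _
  · rintro ⟨x, y⟩ hp ⟨x', y'⟩ hp' h
    have h := congrArg Subtype.val h
    simp only [mem_product, mem_compl] at hp hp'
    simp only [johnsonSwap] at h
    have h1 := congrArg (s.1 \ ·) h
    have h2 := congrArg (· \ s.1) h
    simp only [sdiff_insert_erase hp.1 hp.2, sdiff_insert_erase hp'.1 hp'.2,
      insert_erase_sdiff hp.2, insert_erase_sdiff hp'.2, singleton_inj] at h1 h2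
    rw [h1, h2]
  · intro t ht
    rw [SimpleGraph.mem_neighborFinset] at ht
    obtain ⟨x, hx⟩ := card_eq_one.1 ht.1
    obtain ⟨y, hy⟩ := card_eq_one.1 ht.2
    have hx' : x ∈ s.1 \ t.1 := by simp [hx]
    have hy' : y ∈ t.1 \ s.1 := by simp [hy]
    rw [mem_sdiff] at hx' hy'
    refine ⟨(x, y), by simp [hx'.1, hy'.2], Subtype.ext ?_⟩
    ext z
    have h1 := Finset.ext_iff.1 hx z
    have h2 := Finset.ext_iff.1 hy z
    simp only [mem_sdiff, mem_singleton] at h1 h2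
    simp only [johnsonSwap, mem_insert, mem_erase]
    grind
  · intro p hp
    rfl

theorem johnsonGraph_isRegularOfDegree (n k : ℕ) :
    (johnsonGraph n k).IsRegularOfDegree (k * (n - k)) := by
  intro s
  have h := johnsonGraph_sum_neighborFinset s fun _ => 1
  simpa [card_compl, s.2] using h

theorem johnsonGraph_adjMatrix_sq_apply {n k : ℕ} {s t : {s : Finset (Fin n) // s.card = k}}
    (h : (johnsonGraph n k).Adj s t) :
    ((johnsonGraph n k).adjMatrix ℝ ^ 2) s t = (n : ℝ) - 2 := by
  obtain ⟨a, ha⟩ := card_eq_one.1 h.1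
  obtain ⟨b, hb⟩ := card_eq_one.1 h.2
  have ha' : a ∈ s.1 ∧ a ∉ t.1 := by rw [← mem_sdiff, ha]; simp
  have hb' : b ∈ t.1 ∧ b ∉ s.1 := by rw [← mem_sdiff, hb]; simp
  have ht : t.1 = insert b (s.1.erase a) := by
    ext z
    have h1 := Finset.ext_iff.1 ha z
    have h2 := Finset.ext_iff.1 hb z
    simp only [mem_sdiff, mem_singleton] at h1 h2
    simp only [mem_insert, mem_erase]
    grind
  rw [pow_two, SimpleGraph.adjMatrix_mul_apply]
  have h1 := johnsonGraph_sum_neighborFinset s fun u =>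
    if (u \ t.1).card = 1 ∧ (t.1 \ u).card = 1 then (1 : ℝ) else 0
  simp only [SimpleGraph.adjMatrix_apply]
  refine Eq.trans h1 ?_
  -- The exchange `(x, y)` gives a common neighbour iff exactly one of `x = a`, `y = b` holds.
  -- Summing this exclusive or yields `(n - k) + k - 2`.
  have h2 : ∀ x ∈ s.1, ∀ y ∈ s.1ᶜ,
      (if (insert y (s.1.erase x) \ t.1).card = 1 ∧ (t.1 \ insert y (s.1.erase x)).card = 1
        then (1 : ℝ) else 0) =
      (if x = a then 1 else 0) + (if y = b then 1 else 0)
        - 2 * ((if x = a then 1 else 0) * (if y = b then 1 else 0)) := by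
    intro x hx y hy
    rw [mem_compl] at hy
    have hcard : (insert y (s.1.erase x) \ t.1).card = (t.1 \ insert y (s.1.erase x)).card :=
      card_sdiff_comm_of_card_eq ((johnsonSwap s x y hx hy).2.trans t.2.symm)
    simp only [← hcard, and_self]
    by_cases hxa : x = a <;> by_cases hyb : y = b
    · have : insert y (s.1.erase x) \ t.1 = ∅ := by rw [ht, hxa, hyb, sdiff_self]; rfl
      rw [this]; norm_num [hxa, hyb]
    · have : insert y (s.1.erase x) \ t.1 = {y} := by
        ext z; simp only [ht, mem_sdiff, mem_insert, mem_erase, mem_singleton]; grind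
      rw [this]; simp [hxa, hyb]
    · have : insert y (s.1.erase x) \ t.1 = {a} := by
        ext z; simp only [ht, mem_sdiff, mem_insert, mem_erase, mem_singleton]; grind
      rw [this]; simp [hxa, hyb]
    · have : insert y (s.1.erase x) \ t.1 = {y, a} := by
        ext z; simp only [ht, mem_sdiff, mem_insert, mem_erase, mem_singleton]; grind
      have hya : y ≠ a := fun h => hy (h ▸ ha'.1)
      rw [this]; simp [hxa, hyb, card_pair hya]
  rw [sum_congr rfl fun x hx => sum_congr rfl (h2 x hx)]
  have hkn : k ≤ n := by simpa [s.2] using card_le_univ s.1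
  simp [sum_add_distrib, ha'.1, hb'.2, s.2, card_compl, Nat.cast_sub hkn]

theorem johnsonGraph_adjMatrix_cube_apply_self {n k : ℕ} (s : {s : Finset (Fin n) // s.card = k}) :
    ((johnsonGraph n k).adjMatrix ℝ ^ 3) s s = ((k * (n - k) : ℕ) : ℝ) * ((n : ℝ) - 2) := by
  rw [pow_succ', SimpleGraph.adjMatrix_mul_apply,
    sum_congr rfl fun t ht => johnsonGraph_adjMatrix_sq_apply
      ((SimpleGraph.mem_neighborFinset _ _ _).1 ht).symm, sum_const, nsmul_eq_mul,
    SimpleGraph.card_neighborFinset_eq_degree, johnsonGraph_isRegularOfDegree n k s]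

/-! ### The spectrum of the Johnson graph -/

/-- The up operator on functions on the subsets of a finite set. -/
def upOp (n : ℕ) : (Finset (Fin n) → ℝ) →ₗ[ℝ] (Finset (Fin n) → ℝ) where
  toFun f s := ∑ x ∈ s, f (s.erase x)
  map_add' f g := by ext s; simp [sum_add_distrib]
  map_smul' c f := by ext s; simp [mul_sum]

/-- The down operator on functions on the subsets of a finite set. -/
def downOp (n : ℕ) : (Finset (Fin n) → ℝ) →ₗ[ℝ] (Finset (Fin n) → ℝ) where
  toFun f s := ∑ y ∈ sᶜ, f (insert y s)
  map_add' f g := by ext s; simp [sum_add_distrib]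
  map_smul' c f := by ext s; simp [mul_sum]

/-- `f` vanishes outside the `k`-element sets. -/
def IsSupportedOnLevel {n : ℕ} (k : ℕ) (f : Finset (Fin n) → ℝ) : Prop :=
  ∀ s, s.card ≠ k → f s = 0

theorem IsSupportedOnLevel.upOp {n k : ℕ} {f : Finset (Fin n) → ℝ} (hf : IsSupportedOnLevel k f) :
    IsSupportedOnLevel (k + 1) (upOp n f) := by
  intro s hs
  refine sum_eq_zero fun x hx => hf _ ?_
  have := card_pos.2 ⟨x, hx⟩
  rw [card_erase_of_mem hx]
  omega

theorem IsSupportedOnLevel.downOp {n k : ℕ} {f : Finset (Fin n) → ℝ}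
    (hf : IsSupportedOnLevel (k + 1) f) : IsSupportedOnLevel k (downOp n f) := by
  intro s hs
  refine sum_eq_zero fun y hy => hf _ ?_
  rw [card_insert_of_notMem (mem_compl.1 hy)]
  omega

/-- The diagonal term comes from putting back the element just removed. The exchange sum is the same
as in `downOp_upOp_apply`, so it cancels in the commutator. -/
theorem upOp_downOp_apply {n : ℕ} (f : Finset (Fin n) → ℝ) (s : Finset (Fin n)) :
    upOp n (downOp n f) s =
      s.card * f s + ∑ x ∈ s, ∑ y ∈ sᶜ, f (insert y (s.erase x)) := by
  have h : ∀ x ∈ s, downOp n f (s.erase x) = f s + ∑ y ∈ sᶜ, f (insert y (s.erase x)) := by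
    intro x hx
    change ∑ y ∈ (s.erase x)ᶜ, f (insert y (s.erase x)) = _
    rw [compl_erase, sum_insert (by simpa using hx), insert_erase hx]
  change ∑ x ∈ s, downOp n f (s.erase x) = _
  rw [sum_congr rfl h, sum_add_distrib, sum_const, nsmul_eq_mul]

theorem downOp_upOp_apply {n : ℕ} (f : Finset (Fin n) → ℝ) (s : Finset (Fin n)) :
    downOp n (upOp n f) s =
      sᶜ.card * f s + ∑ x ∈ s, ∑ y ∈ sᶜ, f (insert y (s.erase x)) := by
  have h : ∀ y ∈ sᶜ, upOp n f (insert y s) = f s + ∑ x ∈ s, f (insert y (s.erase x)) := by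
    intro y hy
    rw [mem_compl] at hy
    change ∑ x ∈ insert y s, f ((insert y s).erase x) = _
    rw [sum_insert hy, erase_insert hy]
    congr 1
    refine sum_congr rfl fun x hx => ?_
    rw [erase_insert_of_ne (by rintro rfl; exact hy hx)]
  change ∑ y ∈ sᶜ, upOp n f (insert y s) = _
  rw [sum_congr rfl h, sum_add_distrib, sum_const, nsmul_eq_mul, sum_comm]

theorem IsSupportedOnLevel.downOp_upOp {n k : ℕ} {f : Finset (Fin n) → ℝ}
    (hf : IsSupportedOnLevel k f) :
    _root_.downOp n (_root_.upOp n f) =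
      _root_.upOp n (_root_.downOp n f) + ((n : ℝ) - 2 * k) • f := by
  ext s
  rw [Pi.add_apply, downOp_upOp_apply, upOp_downOp_apply, Pi.smul_apply, smul_eq_mul]
  by_cases hs : s.card = k
  · have hkn : s.card ≤ n := by simpa using card_le_univ s
    rw [card_compl, Fintype.card_fin, Nat.cast_sub hkn, hs]
    ring
  · rw [hf s hs]
    ring

/-- `μ` is an eigenvalue of the composition of the down and the up operator on level `k`. -/
def HasLevelEigenvalue (n k : ℕ) (μ : ℝ) : Prop :=
  ∃ f : Finset (Fin n) → ℝ, f ≠ 0 ∧ IsSupportedOnLevel k f ∧ upOp n (downOp n f) = μ • f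

/-- A dimension count: below the middle level, `downOp` maps level `k + 1` to a space of smaller
dimension. -/
theorem exists_downOp_eq_zero {n k : ℕ} (h : 2 * (k + 1) ≤ n) :
    ∃ f : Finset (Fin n) → ℝ, f ≠ 0 ∧ IsSupportedOnLevel (k + 1) f ∧ downOp n f = 0 := by
  let E : ({s : Finset (Fin n) // s.card = k + 1} → ℝ) →ₗ[ℝ] (Finset (Fin n) → ℝ) :=
    Function.ExtendByZero.linearMap ℝ Subtype.val
  let R : (Finset (Fin n) → ℝ) →ₗ[ℝ] ({s : Finset (Fin n) // s.card = k} → ℝ) :=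
    LinearMap.funLeft ℝ ℝ Subtype.val
  have hlt : n.choose k < n.choose (k + 1) := by
    have h1 := Nat.choose_succ_right_eq n k
    have h2 : 0 < n.choose k := Nat.choose_pos (by omega)
    have h3 : k + 2 ≤ n - k := by omega
    nlinarith [Nat.mul_le_mul_left (n.choose k) h3]
  have hker : LinearMap.ker (R ∘ₗ downOp n ∘ₗ E) ≠ ⊥ :=
    LinearMap.ker_ne_bot_of_finrank_lt (by simpa using hlt)
  obtain ⟨g, hg, hg0⟩ := Submodule.exists_mem_ne_zero_of_ne_bot hker
  have hE : ∀ s, E g s.1 = g s := fun s => Subtype.val_injective.extend_apply g (0 : Finset (Fin n) → ℝ) s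
  have hsupp : IsSupportedOnLevel (k + 1) (E g) := by
    intro s hs
    exact Function.extend_apply' g (0 : Finset (Fin n) → ℝ) s fun ⟨a, ha⟩ => hs (ha ▸ a.2)
  refine ⟨E g, fun h0 => hg0 (funext fun s => by rw [← hE, h0]; rfl), hsupp, ?_⟩
  ext s
  by_cases hs : s.card = k
  · exact congrFun (LinearMap.mem_ker.1 hg) ⟨s, hs⟩
  · exact hsupp.downOp s hs

theorem hasLevelEigenvalue_zero_iff (n : ℕ) (μ : ℝ) : HasLevelEigenvalue n 0 μ ↔ μ = 0 := by
  have key : ∀ f : Finset (Fin n) → ℝ, IsSupportedOnLevel 0 f → downOp n f = 0 := by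
    intro f hf
    ext s
    exact sum_eq_zero fun y _ => hf _ (by simp)
  constructor
  · rintro ⟨f, hf0, hf, h⟩
    rw [key f hf, map_zero] at h
    exact (smul_eq_zero.1 h.symm).resolve_right hf0
  · rintro rfl
    have hf : IsSupportedOnLevel 0 (Pi.single ∅ 1 : Finset (Fin n) → ℝ) := fun s hs =>
      Pi.single_eq_of_ne (fun h => hs (by simp [h])) _
    refine ⟨_, fun h => ?_, hf, by rw [key _ hf]; simp⟩
    simpa using congrFun h ∅

/-- For `μ ≠ 0`, `downOp` and `upOp` carry eigenvectors of `UD` on level `k + 1` to those of `DU` on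
level `k` and back; the commutator turns `DU` into `UD` with a shift. -/
theorem hasLevelEigenvalue_succ_iff {n k : ℕ} (h : 2 * (k + 1) ≤ n) (μ : ℝ) :
    HasLevelEigenvalue n (k + 1) μ ↔ μ = 0 ∨ HasLevelEigenvalue n k (μ - ((n : ℝ) - 2 * k)) := by
  constructor
  · rintro ⟨f, hf0, hf, hfμ⟩
    by_cases hμ : μ = 0
    · exact .inl hμ
    refine .inr ⟨downOp n f, fun h0 => ?_, hf.downOp, ?_⟩
    · rw [h0, map_zero] at hfμ
      exact (smul_ne_zero hμ hf0) hfμ.symm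
    · have := hf.downOp.downOp_upOp
      rw [hfμ, map_smul] at this
      rw [sub_smul, this, add_sub_cancel_right]
  · intro h'
    by_cases hμ : μ = 0
    · obtain ⟨f, hf0, hf, hd⟩ := exists_downOp_eq_zero h
      exact ⟨f, hf0, hf, by rw [hd, hμ]; simp⟩
    obtain ⟨g, hg0, hg, hgμ⟩ := h'.resolve_left hμ
    have hdu : downOp n (upOp n g) = μ • g := by
      rw [hg.downOp_upOp, hgμ, ← add_smul, sub_add_cancel]
    refine ⟨upOp n g, fun h0 => ?_, hg.upOp, by rw [hdu, map_smul]⟩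
    rw [h0, map_zero] at hdu
    exact (smul_ne_zero hμ hg0) hdu.symm

theorem johnsonGraph_adjMatrix_mulVec {n k : ℕ} (f : Finset (Fin n) → ℝ)
    (s : {s : Finset (Fin n) // s.card = k}) :
    ((johnsonGraph n k).adjMatrix ℝ).mulVec (fun t => f t.1) s =
      upOp n (downOp n f) s.1 - k * f s.1 := by
  rw [SimpleGraph.adjMatrix_mulVec_apply, johnsonGraph_sum_neighborFinset s f, upOp_downOp_apply,
    s.2]
  ring

theorem mem_spectrum_johnsonGraph_iff {n k : ℕ} (μ : ℝ) :
    μ ∈ spectrum ℝ ((johnsonGraph n k).adjMatrix ℝ) ↔ HasLevelEigenvalue n k (μ + k) := by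
  rw [← Matrix.spectrum_toLin', ← Module.End.hasEigenvalue_iff_mem_spectrum]
  constructor
  · intro h
    obtain ⟨g, hg⟩ := h.exists_hasEigenvector
    let f : Finset (Fin n) → ℝ := Function.extend Subtype.val g (0 : Finset (Fin n) → ℝ)
    have hE : ∀ s : {s : Finset (Fin n) // s.card = k}, f s.1 = g s :=
      fun s => Subtype.val_injective.extend_apply g (0 : Finset (Fin n) → ℝ) s
    have hsupp : IsSupportedOnLevel k f := fun s hs =>
      Function.extend_apply' g (0 : Finset (Fin n) → ℝ) s fun ⟨a, ha⟩ => hs (ha ▸ a.2)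
    refine ⟨f, fun h0 => hg.2 (funext fun s => by rw [← hE, h0]; rfl), hsupp, ?_⟩
    ext s
    by_cases hs : s.card = k
    · have h1 := congrFun hg.apply_eq_smul ⟨s, hs⟩
      have h2 := johnsonGraph_adjMatrix_mulVec f ⟨s, hs⟩
      rw [funext hE] at h2
      rw [Matrix.toLin'_apply, h2, Pi.smul_apply, ← hE] at h1
      simp only [smul_eq_mul, Pi.smul_apply] at h1 ⊢
      linarith
    · rw [upOp_downOp_apply, Pi.smul_apply, hsupp s hs]
      -- Exchanges preserve cardinality, so off level `k` both sides vanish.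
      have : ∀ x ∈ s, ∀ y ∈ sᶜ, f (insert y (s.erase x)) = 0 := by
        intro x hx y hy
        refine hsupp _ ?_
        rw [show (insert y (s.erase x)).card = s.card from
          (johnsonSwap ⟨s, rfl⟩ x y hx (mem_compl.1 hy)).2]
        exact hs
      rw [sum_congr rfl fun x hx => sum_congr rfl (this x hx)]
      simp
  · rintro ⟨f, hf0, hf, h⟩
    refine Module.End.hasEigenvalue_of_hasEigenvector (x := fun s => f s.1)
      (Module.End.hasEigenvector_iff.2 ⟨Module.End.mem_eigenspace_iff.2 ?_, fun h0 => hf0 ?_⟩)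
    · ext s
      rw [Matrix.toLin'_apply, johnsonGraph_adjMatrix_mulVec, h]
      simp only [Pi.smul_apply, smul_eq_mul]
      ring
    · ext s
      by_cases hs : s.card = k
      · exact congrFun h0 ⟨s, hs⟩
      · exact hf s hs

theorem spectrum_johnsonGraph_three {n : ℕ} (hn : 6 ≤ n) :
    spectrum ℝ ((johnsonGraph n 3).adjMatrix ℝ) =
      {3 * (n : ℝ) - 9, 2 * (n : ℝ) - 9, (n : ℝ) - 7, -3} := by
  ext μ
  rw [mem_spectrum_johnsonGraph_iff, hasLevelEigenvalue_succ_iff (by omega),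
    hasLevelEigenvalue_succ_iff (by omega), hasLevelEigenvalue_succ_iff (by omega),
    hasLevelEigenvalue_zero_iff]
  simp only [Set.mem_insert_iff, Set.mem_singleton_iff]
  push_cast
  constructor
  · rintro (h | h | h | h)
    · exact .inr (.inr (.inr (by linarith)))
    · exact .inr (.inr (.inl (by linarith)))
    · exact .inr (.inl (by linarith))
    · exact .inl (by linarith)
  · rintro (h | h | h | h)
    · exact .inr (.inr (.inr (by linarith)))
    · exact .inr (.inr (.inl (by linarith)))
    · exact .inr (.inl (by linarith))
    · exact .inl (by linarith)

theorem spectrum_johnsonGraph_four {n : ℕ} (hn : 8 ≤ n) :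
    spectrum ℝ ((johnsonGraph n 4).adjMatrix ℝ) =
      {4 * (n : ℝ) - 16, 3 * (n : ℝ) - 16, 2 * (n : ℝ) - 14, (n : ℝ) - 10, -4} := by
  ext μ
  rw [mem_spectrum_johnsonGraph_iff, hasLevelEigenvalue_succ_iff (by omega),
    hasLevelEigenvalue_succ_iff (by omega), hasLevelEigenvalue_succ_iff (by omega),
    hasLevelEigenvalue_succ_iff (by omega), hasLevelEigenvalue_zero_iff]
  simp only [Set.mem_insert_iff, Set.mem_singleton_iff]
  push_cast
  constructor
  · rintro (h | h | h | h | h)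
    · exact .inr (.inr (.inr (.inr (by linarith))))
    · exact .inr (.inr (.inr (.inl (by linarith))))
    · exact .inr (.inr (.inl (by linarith)))
    · exact .inr (.inl (by linarith))
    · exact .inl (by linarith)
  · rintro (h | h | h | h | h)
    · exact .inr (.inr (.inr (.inr (by linarith))))
    · exact .inr (.inr (.inr (.inl (by linarith))))
    · exact .inr (.inr (.inl (by linarith)))
    · exact .inr (.inl (by linarith))
    · exact .inl (by linarith)

/-! ### The ratio-type bounds -/

/-- This and the next two lemmas describe values of `θ` by order within its range, so they can be
read off the spectrum for arbitrary `d` and index. -/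
theorem StrictAnti.isGreatest_range_zero {d : ℕ} {θ : Fin (d + 1) → ℝ} (h : StrictAnti θ) :
    IsGreatest (Set.range θ) (θ 0) :=
  ⟨⟨0, rfl⟩, by rintro _ ⟨i, rfl⟩; exact h.antitone (Fin.zero_le i)⟩

theorem StrictAnti.isLeast_range_last {d : ℕ} {θ : Fin (d + 1) → ℝ} (h : StrictAnti θ) :
    IsLeast (Set.range θ) (θ (Fin.last d)) :=
  ⟨⟨_, rfl⟩, by rintro _ ⟨i, rfl⟩; exact h.antitone (Fin.le_last i)⟩

theorem StrictAnti.isLeast_range_castSucc {d : ℕ} {θ : Fin (d + 1) → ℝ} (h : StrictAnti θ)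
    (i : Fin d) : IsLeast {x | x ∈ Set.range θ ∧ θ i.succ < x} (θ i.castSucc) := by
  refine ⟨⟨⟨_, rfl⟩, h Fin.castSucc_lt_succ⟩, ?_⟩
  rintro _ ⟨⟨j, rfl⟩, hj⟩
  exact h.antitone (Fin.le_castSucc_iff.2 (h.lt_iff_gt.1 hj))

theorem cast_choose_three (n : ℕ) :
    ((n.choose 3 : ℕ) : ℝ) = (n : ℝ) * (n - 1) * (n - 2) / 6 := by
  rw [Nat.cast_choose_eq_descPochhammer_div]
  simp [descPochhammer, Nat.factorial]
  ring

theorem cast_choose_four (n : ℕ) :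
    ((n.choose 4 : ℕ) : ℝ) = (n : ℝ) * (n - 1) * (n - 2) * (n - 3) / 24 := by
  rw [Nat.cast_choose_eq_descPochhammer_div]
  simp [descPochhammer, Nat.factorial]
  ring

theorem johnsonGraph_exists_ratioThreeSetting {n : ℕ} (hn : 6 < n) :
    ∃ (r d : ℕ) (θ : Fin (d + 1) → ℝ) (i : Fin d),
      RatioThreeSetting (johnsonGraph n 3) r d θ i := by
  have hn' : (7 : ℝ) ≤ n := by exact_mod_cast hn
  have hr : Set.range ![3 * (n : ℝ) - 9, 2 * (n : ℝ) - 9, (n : ℝ) - 7, -3] =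
      {3 * (n : ℝ) - 9, 2 * (n : ℝ) - 9, (n : ℝ) - 7, -3} := by
    simp only [Matrix.range_cons, Matrix.range_empty, Set.union_empty, Set.singleton_union]
  refine ⟨3 * (n - 3), 3, ![3 * (n : ℝ) - 9, 2 * (n : ℝ) - 9, (n : ℝ) - 7, -3], 2,
    ⟨johnsonGraph_isRegularOfDegree n 3, ?_, ?_, ?_⟩, by norm_num, ?_⟩
  · rw [Fin.strictAnti_iff_succ_lt]
    intro i
    fin_cases i <;> simp <;> linarith
  · rw [hr, spectrum_johnsonGraph_three hn.le]
  · rw [Nat.cast_mul, Nat.cast_sub (by omega)]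
    simp
    ring
  · rw [hr]
    refine ⟨⟨by simp, by simp⟩, ?_⟩
    rintro x ⟨rfl | rfl | rfl | rfl, hx⟩
    · linarith
    · linarith
    · linarith
    · simp

theorem RatioThreeSetting.ratioBoundThree_johnsonGraph {n : ℕ} (hn : 6 < n) {r d : ℕ}
    {θ : Fin (d + 1) → ℝ} {i : Fin d} (h : RatioThreeSetting (johnsonGraph n 3) r d θ i) :
    ratioBoundThree (Fintype.card {s : Finset (Fin n) // s.card = 3}) θ i = (n : ℝ) / 3 := by
  have hn' : (7 : ℝ) ≤ n := by exact_mod_cast hn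
  have hr := h.eigenvalues.range_eq
  have hθ := h.eigenvalues.strictAnti
  rw [spectrum_johnsonGraph_three hn.le] at hr
  have h0 : θ 0 = 3 * (n : ℝ) - 9 := by
    refine hθ.isGreatest_range_zero.unique ?_
    rw [hr]
    refine ⟨by simp, ?_⟩
    rintro x (rfl | rfl | rfl | rfl) <;> linarith
  have h1 : θ i.succ = -3 := by
    refine h.isGreatest.unique ?_
    rw [hr]
    refine ⟨⟨by simp, by norm_num⟩, ?_⟩
    -- Here `n > 6` matters: it gives `n - 7 > -1`, leaving only `-3`.
    rintro x ⟨rfl | rfl | rfl | rfl, hx⟩ <;> linarith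
  have h2 : θ i.castSucc = (n : ℝ) - 7 := by
    refine (hθ.isLeast_range_castSucc i).unique ?_
    rw [hr, h1]
    refine ⟨⟨by simp, by linarith⟩, ?_⟩
    rintro x ⟨rfl | rfl | rfl | rfl, hx⟩ <;> linarith
  rw [ratioBoundThree, h0, h1, h2, Fintype.card_finset_len, Fintype.card_fin, cast_choose_three]
  rw [show 3 * (n : ℝ) - 9 - -3 = 3 * (n - 2) by ring,
    show 3 * (n : ℝ) - 9 - (n - 7) = 2 * (n - 1) by ring]
  have e1 : (n : ℝ) - 2 ≠ 0 := by linarith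
  have e2 : (n : ℝ) - 1 ≠ 0 := by linarith
  field_simp
  ring

theorem johnsonGraph_isGreatest_diag {n k : ℕ} (hkn : k ≤ n) :
    IsGreatest (Set.range fun u => ((johnsonGraph n k).adjMatrix ℝ ^ 3) u u)
      (((k * (n - k) : ℕ) : ℝ) * ((n : ℝ) - 2)) := by
  obtain ⟨s, -, hs⟩ := exists_subset_card_eq (s := (univ : Finset (Fin n))) (n := k) (by simpa)
  refine ⟨⟨⟨s, hs⟩, johnsonGraph_adjMatrix_cube_apply_self _⟩, ?_⟩
  rintro _ ⟨u, rfl⟩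
  exact (johnsonGraph_adjMatrix_cube_apply_self u).le

/-- The common factor `θ 0 = 4n - 16` cancels, leaving `(3n - 18) / 3`. -/
theorem ratioFour_threshold {n : ℝ} (hn : 9 ≤ n) :
    -(((4 * n - 16) ^ 2 + (4 * n - 16) * (-4) - (4 * n - 16) * (n - 2)) /
      ((4 * n - 16) * (-4 + 1))) = n - 6 := by
  have e : 4 * n - 16 ≠ 0 := by linarith
  rw [neg_eq_iff_eq_neg, div_eq_iff (mul_ne_zero e (by norm_num))]
  ring

theorem johnsonGraph_exists_ratioFourSetting {n : ℕ} (hn : 8 < n) :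
    ∃ (r d : ℕ) (θ : Fin (d + 1) → ℝ) (Δ : ℝ) (s : Fin d),
      RatioFourSetting (johnsonGraph n 4) r d θ Δ s := by
  have hn' : (9 : ℝ) ≤ n := by exact_mod_cast hn
  have hr : Set.range ![4 * (n : ℝ) - 16, 3 * (n : ℝ) - 16, 2 * (n : ℝ) - 14, (n : ℝ) - 10, -4] =
      {4 * (n : ℝ) - 16, 3 * (n : ℝ) - 16, 2 * (n : ℝ) - 14, (n : ℝ) - 10, -4} := by
    simp only [Matrix.range_cons, Matrix.range_empty, Set.union_empty, Set.singleton_union]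
  have hdeg : ((4 * (n - 4) : ℕ) : ℝ) = 4 * (n : ℝ) - 16 := by
    rw [Nat.cast_mul, Nat.cast_sub (by omega)]
    push_cast
    ring
  refine ⟨4 * (n - 4), 4,
    ![4 * (n : ℝ) - 16, 3 * (n : ℝ) - 16, 2 * (n : ℝ) - 14, (n : ℝ) - 10, -4],
    _, 2, ⟨johnsonGraph_isRegularOfDegree n 4, ?_, ?_, ?_⟩, by norm_num,
    johnsonGraph_isGreatest_diag (by omega), ?_⟩
  · rw [Fin.strictAnti_iff_succ_lt]
    intro i
    fin_cases i <;> simp <;> linarith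
  · rw [hr, spectrum_johnsonGraph_four hn.le]
  · rw [hdeg]
    simp
  · rw [hr, hdeg]
    change IsGreatest {x : ℝ | _ ∧ x ≤ -(((4 * (n : ℝ) - 16) ^ 2 + (4 * (n : ℝ) - 16) * (-4) -
      (4 * (n : ℝ) - 16) * (n - 2)) / ((4 * (n : ℝ) - 16) * (-4 + 1)))} ((n : ℝ) - 10)
    rw [ratioFour_threshold hn']
    refine ⟨⟨by simp, by linarith⟩, ?_⟩
    rintro x ⟨rfl | rfl | rfl | rfl | rfl, hx⟩ <;> linarith

theorem RatioFourSetting.ratioBoundFour_johnsonGraph {n : ℕ} (hn : 8 < n) {r d : ℕ}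
    {θ : Fin (d + 1) → ℝ} {Δ : ℝ} {s : Fin d}
    (h : RatioFourSetting (johnsonGraph n 4) r d θ Δ s) :
    ratioBoundFour (Fintype.card {s : Finset (Fin n) // s.card = 4}) θ Δ s = (n : ℝ) / 4 := by
  have hn' : (9 : ℝ) ≤ n := by exact_mod_cast hn
  have hr := h.eigenvalues.range_eq
  have hθ := h.eigenvalues.strictAnti
  rw [spectrum_johnsonGraph_four hn.le] at hr
  have h0 : θ 0 = 4 * (n : ℝ) - 16 := by
    refine hθ.isGreatest_range_zero.unique ?_
    rw [hr]
    refine ⟨by simp, ?_⟩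
    rintro x (rfl | rfl | rfl | rfl | rfl) <;> linarith
  have hl : θ (Fin.last d) = -4 := by
    refine hθ.isLeast_range_last.unique ?_
    rw [hr]
    refine ⟨by simp, ?_⟩
    rintro x (rfl | rfl | rfl | rfl | rfl) <;> linarith
  have hΔ : Δ = (4 * (n : ℝ) - 16) * ((n : ℝ) - 2) := by
    rw [h.isGreatest_diag.unique (johnsonGraph_isGreatest_diag (by omega)), Nat.cast_mul,
      Nat.cast_sub (by omega)]
    push_cast
    ring
  have h1 : θ s.succ = (n : ℝ) - 10 := by
    refine h.isGreatest.unique ?_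
    rw [hr, h0, hl, hΔ, ratioFour_threshold hn']
    refine ⟨⟨by simp, by linarith⟩, ?_⟩
    -- `n > 8` is exactly what places `2n - 14` above the threshold `n - 6`.
    rintro x ⟨rfl | rfl | rfl | rfl | rfl, hx⟩ <;> linarith
  have h2 : θ s.castSucc = 2 * (n : ℝ) - 14 := by
    refine (hθ.isLeast_range_castSucc s).unique ?_
    rw [hr, h1]
    refine ⟨⟨by simp, by linarith⟩, ?_⟩
    rintro x ⟨rfl | rfl | rfl | rfl | rfl, hx⟩ <;> linarith
  rw [ratioBoundFour, h0, h1, h2, hl, hΔ, Fintype.card_finset_len, Fintype.card_fin,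
    cast_choose_four]
  rw [show 4 * (n : ℝ) - 16 - (n - 10) = 3 * (n - 2) by ring,
    show 4 * (n : ℝ) - 16 - (2 * n - 14) = 2 * (n - 1) by ring,
    show 4 * (n : ℝ) - 16 - -4 = 4 * (n - 3) by ring]
  have e1 : (n : ℝ) - 2 ≠ 0 := by linarith
  have e2 : (n : ℝ) - 1 ≠ 0 := by linarith
  have e3 : (n : ℝ) - 3 ≠ 0 := by linarith
  field_simp
  ring

theorem floor_natCast_div_eq (n k : ℕ) : ((n / k : ℕ) : ℤ) = ⌊(n : ℝ) / k⌋ := by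
  rw [← Nat.floor_div_eq_div (K := ℝ) n k, Int.natCast_floor_eq_floor (by positivity)]

theorem mainTheorem10 :
    (∀ n k : ℕ, 1 ≤ k →
      (∀ U : Set {s : Finset (Fin n) // s.card = k},
        IsEquidistantSet (johnsonGraph n k) k U ↔
          ∀ u ∈ U, ∀ v ∈ U, u ≠ v → Disjoint u.1 v.1) ∧
      equidistantNumber (johnsonGraph n k) k = n / k) ∧
    (∀ n : ℕ, 6 < n →
      (∃ (r d : ℕ) (θ : Fin (d + 1) → ℝ) (i : Fin d),
        RatioThreeSetting (johnsonGraph n 3) r d θ i) ∧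
      (∀ (r d : ℕ) (θ : Fin (d + 1) → ℝ) (i : Fin d),
        RatioThreeSetting (johnsonGraph n 3) r d θ i →
          ratioBoundThree (Fintype.card {s : Finset (Fin n) // s.card = 3}) θ i = (n : ℝ) / 3 ∧
          (equidistantNumber (johnsonGraph n 3) 3 : ℤ) =
            ⌊ratioBoundThree (Fintype.card {s : Finset (Fin n) // s.card = 3}) θ i⌋)) ∧
    (∀ n : ℕ, 8 < n →
      (∃ (r d : ℕ) (θ : Fin (d + 1) → ℝ) (Δ : ℝ) (s : Fin d),
        RatioFourSetting (johnsonGraph n 4) r d θ Δ s) ∧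
      (∀ (r d : ℕ) (θ : Fin (d + 1) → ℝ) (Δ : ℝ) (s : Fin d),
        RatioFourSetting (johnsonGraph n 4) r d θ Δ s →
          ratioBoundFour (Fintype.card {s : Finset (Fin n) // s.card = 4}) θ Δ s = (n : ℝ) / 4 ∧
          (equidistantNumber (johnsonGraph n 4) 4 : ℤ) =
            ⌊ratioBoundFour (Fintype.card {s : Finset (Fin n) // s.card = 4}) θ Δ s⌋)) := by
  refine ⟨fun n k hk => ⟨johnsonGraph_isEquidistantSet_iff, equidistantNumber_johnsonGraph n k hk⟩,
    fun n hn => ⟨johnsonGraph_exists_ratioThreeSetting hn, fun r d θ i h => ?_⟩,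
    fun n hn => ⟨johnsonGraph_exists_ratioFourSetting hn, fun r d θ Δ s h => ?_⟩⟩
  · have hb := h.ratioBoundThree_johnsonGraph hn
    refine ⟨hb, ?_⟩
    rw [hb, equidistantNumber_johnsonGraph n 3 (by norm_num)]
    exact_mod_cast floor_natCast_div_eq n 3
  · have hb := h.ratioBoundFour_johnsonGraph hn
    refine ⟨hb, ?_⟩
    rw [hb, equidistantNumber_johnsonGraph n 4 (by norm_num)]
    exact_mod_cast floor_natCast_div_eq n 4
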